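/- Let $(X,\mathcal S)$ be a standard Borel space with a finite nonatomic measure $\mu$, and let $T:X\to X$ be a (not necessarily invertible) measurable, $\mu$-preserving, ergodic transformation. All metrics are assumed to be bounded by $1$ and Borel measurable on the product of the space with itself; a metric $d$ on a measure space $(Y,\nu)$ is called $\nu$-compatible if every open $d$-ball of positive radius has positive $\nu$-measure. $T$ is Li-Yorke M-sensitive if for every $\mu$-compatible metric $d$ on $X$, for $\mu\times\mu$-almost every $(x,y)\in X\times X$, $$\liminf_{n\to\infty} d(T^nx,T^ny)=0\quad\text{and}\quad \limsup_{n\to\infty} d(T^nx,T^ny)>0 .$$ $T$ is weakly mixing if every $f\in L^\infty(\mu)$ with $f\circ T=zf$ a.e. for some $z\in\mathbb C$ is constant a.e. A factor of $T$ is a measure-preserving system $(Y,\nu,S)$ on a standard Borel space $Y$ ($\nu$ may have atoms) together with a measurable map $\pi:X\to Y$ such that $\pi_*\mu=\nu$ and $\pi\circ T=S\circ\pi$ $\mu$-a.e.; it is nontrivial if some measurable $A\subset Y$ has $\nu(A)>0$ and $\nu(Y\setminus A)>0$. Then the following are equivalent: 1. $T$ is Li-Yorke M-sensitive. 2. $T$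 is weakly mixing. 3. No nontrivial factor $(Y,\nu,S)$ of $T$ admits a $\nu$-compatible metric $d$ with $d(Sx,Sy)=d(x,y)$ for all $x,y\in Y$. -/

import Mathlib

open MeasureTheory Filter

namespace LiYorke

universe u

/-- `d` is a metric on `X`, bounded by `1`, Borel measurable on `X × X`, and `μ`-compatible:
every open `d`-ball of positive radius has positive measure. -/
structure IsCompatibleMetric {X : Type u} [MeasurableSpace X] (μ : Measure X)
    (d : X → X → ℝ) : Prop where
  eq_zero_iff : ∀ x y, d x y = 0 ↔ x = y
  symm : ∀ x y, d x y = d y x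
  triangle : ∀ x y z, d x z ≤ d x y + d y z
  le_one : ∀ x y, d x y ≤ 1
  measurable : Measurable (fun p : X × X => d p.1 p.2)
  ball_pos : ∀ x r, 0 < r → 0 < μ {y | d x y < r}

/-- `(x, y)` is a Li-Yorke pair for `T` and `d`. For a metric bounded by `1` the two limits are
those of a bounded real sequence. -/
def IsLiYorkePair {X : Type u} (T : X → X) (d : X → X → ℝ) (x y : X) : Prop :=
  liminf (fun n : ℕ => d (T^[n] x) (T^[n] y)) atTop = 0 ∧
    0 < limsup (fun n : ℕ => d (T^[n] x) (T^[n] y)) atTop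

/-- Li-Yorke M-sensitivity: for every `μ`-compatible metric almost every pair is Li-Yorke. -/
def IsLiYorkeMSensitive {X : Type u} [MeasurableSpace X] (T : X → X) (μ : Measure X) : Prop :=
  ∀ d : X → X → ℝ, IsCompatibleMetric μ d →
    ∀ᵐ p ∂(μ.prod μ), IsLiYorkePair T d p.1 p.2

/-- Weak mixing: every `L^∞` eigenfunction is constant almost everywhere. -/
def IsWeaklyMixing {X : Type u} [MeasurableSpace X] (T : X → X) (μ : Measure X) : Prop :=
  ∀ (f : X → ℂ) (z : ℂ), MemLp f ⊤ μ → (∀ᵐ x ∂μ, f (T x) = z * f x) →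
    ∃ c : ℂ, ∀ᵐ x ∂μ, f x = c

/-- `π` is a factor map from the measure-preserving system `(X, μ, T)` onto the
measure-preserving system `(Y, ν, S)`. -/
structure IsFactorMap {X Y : Type u} [MeasurableSpace X] [MeasurableSpace Y]
    (T : X → X) (μ : Measure X) (S : Y → Y) (ν : Measure Y) (π : X → Y) : Prop where
  base : MeasurePreserving S ν ν
  map : MeasurePreserving π μ ν
  equivariant : ∀ᵐ x ∂μ, π (T x) = S (π x)

/-- The measure is not trivial: some measurable set is neither null nor co-null
(on a standard Borel space with nonzero finite measure: it is not concentrated on one point). -/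
def IsNontrivialMeasure {Y : Type u} [MeasurableSpace Y] (ν : Measure Y) : Prop :=
  ∃ A : Set Y, MeasurableSet A ∧ ν A ≠ 0 ∧ ν Aᶜ ≠ 0

/-- Some compatible metric on `(Y, ν)` makes `S` an isometry. -/
def AdmitsCompatibleIsometricMetric {Y : Type u} [MeasurableSpace Y]
    (S : Y → Y) (ν : Measure Y) : Prop :=
  ∃ d : Y → Y → ℝ, IsCompatibleMetric ν d ∧ ∀ x y, d (S x) (S y) = d x y

/-- `(X, μ, T)` has a nontrivial factor on a standard Borel space (atoms allowed) that admits a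
compatible metric for which it is an isometry. -/
def HasNontrivialIsometricFactor {X : Type u} [MeasurableSpace X]
    (T : X → X) (μ : Measure X) : Prop :=
  ∃ (Y : Type u) (_ : MeasurableSpace Y) (_ : StandardBorelSpace Y)
    (ν : Measure Y) (S : Y → Y) (π : X → Y),
    IsFactorMap T μ S ν π ∧ IsNontrivialMeasure ν ∧ AdmitsCompatibleIsometricMetric S ν

end LiYorke

namespace LiYorke

universe u

open scoped InnerProductSpace ComplexConjugate

/-! The proof runs in a cycle: weak mixing gives Li-Yorke M-sensitivity, which excludes isometric
factors, whose absence gives weak mixing.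

The core is a zero-one law for symmetric `T × T`-invariant sets `E`
(`IsWeaklyMixing.prod_null_or_conull`). The kernel `1_E` minus a suitable constant defines a compact
self-adjoint operator that kills constants. If it were nonzero, an eigenspace would be
finite-dimensional and invariant under the Koopman operator (`exists_common_eigenvector`), producing
a nonconstant eigenfunction of `T`. So `1_E` is a.e. constant. With Poincaré recurrence, almost
every pair then visits `{d < ε}` and some `{d > r}` infinitely often.

A compatible metric `d` on a factor lifts to a metric on `X` dominating `d / 2` almost everywhere
(`IsCompatibleMetric.exists_lift`). If the factor is isometric, `d` is constant along orbits of
pairs, so a zero liminf collapses the factor to a point. Conversely, a nonconstant eigenfunction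
maps `X` to a rotation of the support of its distribution in `ℂ`. -/

theorem memLp_tensor {X : Type u} [MeasurableSpace X] (μ : Measure X) [SFinite μ] (f g : Lp ℂ 2 μ) :
    MemLp (fun p : X × X => conj (f p.1) * g p.2) 2 (μ.prod μ) := by
  have hf : AEStronglyMeasurable (fun p : X × X => conj (f p.1) * g p.2) (μ.prod μ) := by
    have h1 : AEStronglyMeasurable (fun p : X × X => f p.1) (μ.prod μ) :=
      (Lp.aestronglyMeasurable f).comp_fst
    have h2 : AEStronglyMeasurable (fun p : X × X => g p.2) (μ.prod μ) :=
      (Lp.aestronglyMeasurable g).comp_snd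
    exact (Complex.continuous_conj.comp_aestronglyMeasurable h1).mul h2
  rw [memLp_two_iff_integrable_sq_norm hf]
  have h1 := (memLp_two_iff_integrable_sq_norm (Lp.aestronglyMeasurable f)).1 (Lp.memLp f)
  have h2 := (memLp_two_iff_integrable_sq_norm (Lp.aestronglyMeasurable g)).1 (Lp.memLp g)
  refine (h1.mul_prod h2).congr (ae_of_all _ fun p => ?_)
  simp [mul_pow]

/-! ### Compactness of integral operators with indicator kernel -/

section KernelOperator

variable {X : Type u} [MeasurableSpace X] (μ : Measure X) [IsProbabilityMeasure μ]

/-- The integral operator on `L²(μ)` whose kernel is the indicator function of `E`. -/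
noncomputable def kernelOp (E : Set (X × X)) : Lp ℂ 2 μ →L[ℂ] Lp ℂ 2 μ :=
  -- Composing the pullback along `Prod.snd` with the adjoint of the pullback along `Prod.fst`, both
  -- restricted to `E`, makes boundedness automatic.
  ContinuousLinearMap.adjoint
      (LpToLpRestrictCLM (X × X) ℂ ℂ (μ.prod μ) 2 E ∘L
        (Lp.compMeasurePreservingₗᵢ ℂ Prod.fst
          (measurePreserving_fst (μ := μ) (ν := μ))).toContinuousLinearMap) ∘L
    (LpToLpRestrictCLM (X × X) ℂ ℂ (μ.prod μ) 2 E ∘L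
      (Lp.compMeasurePreservingₗᵢ ℂ Prod.snd
        (measurePreserving_snd (μ := μ) (ν := μ))).toContinuousLinearMap)

theorem inner_kernelOp (E : Set (X × X)) (f g : Lp ℂ 2 μ) :
    ⟪f, kernelOp μ E g⟫_ℂ = ∫ p in E, conj (f p.1) * g p.2 ∂(μ.prod μ) := by
  simp only [kernelOp, ContinuousLinearMap.comp_apply, ContinuousLinearMap.adjoint_inner_right]
  rw [L2.inner_def]
  apply integral_congr_ae
  have h1 := LpToLpRestrictCLM_coeFn (μ := μ.prod μ) (p := 2) ℂ E
    (Lp.compMeasurePreserving Prod.fst (measurePreserving_fst (μ := μ) (ν := μ)) f)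
  have h2 := LpToLpRestrictCLM_coeFn (μ := μ.prod μ) (p := 2) ℂ E
    (Lp.compMeasurePreserving Prod.snd (measurePreserving_snd (μ := μ) (ν := μ)) g)
  have h3 := ae_restrict_of_ae (s := E)
    (Lp.coeFn_compMeasurePreserving f (measurePreserving_fst (μ := μ) (ν := μ)))
  have h4 := ae_restrict_of_ae (s := E)
    (Lp.coeFn_compMeasurePreserving g (measurePreserving_snd (μ := μ) (ν := μ)))
  filter_upwards [h1, h2, h3, h4] with p h1 h2 h3 h4
  erw [h1, h2, h3, h4]
  simp [mul_comm]

theorem norm_toLp_tensor (f g : Lp ℂ 2 μ) :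
    ‖(memLp_tensor μ f g).toLp‖ = ‖f‖ * ‖g‖ := by
  have key : ∀ {Y : Type u} [MeasurableSpace Y] (ν : Measure Y) (h : Lp ℂ 2 ν),
      ‖h‖ ^ 2 = ∫ y, ‖h y‖ ^ 2 ∂ν := by
    intro Y _ ν h
    have h1 : ⟪h, h⟫_ℂ = ((∫ y, ‖h y‖ ^ 2 ∂ν : ℝ) : ℂ) := by
      rw [L2.inner_def, ← integral_complex_ofReal]
      refine integral_congr_ae (ae_of_all _ fun y => ?_)
      simp
    rw [inner_self_eq_norm_sq_to_K] at h1
    exact Complex.ofReal_injective (by push_cast; exact h1)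
  have h : ‖(memLp_tensor μ f g).toLp‖ ^ 2 = (‖f‖ * ‖g‖) ^ 2 := by
    rw [mul_pow, key, key, key, ← integral_prod_mul]
    refine integral_congr_ae ?_
    filter_upwards [(memLp_tensor μ f g).coeFn_toLp] with p hp
    rw [hp]
    simp [mul_pow]
  exact (pow_left_inj₀ (norm_nonneg _) (by positivity) two_ne_zero).1 h

theorem integrable_tensor (f g : Lp ℂ 2 μ) :
    Integrable (fun p : X × X => conj (f p.1) * g p.2) (μ.prod μ) :=
  (memLp_tensor μ f g).integrable (by norm_num)

/-- Hilbert-Schmidt bound: matrix coefficients are inner products of `1_E` with a tensor, so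
Cauchy-Schwarz applies. It makes the tails small in `isCompactOperator_kernelOp`. -/
theorem norm_kernelOp_le {E : Set (X × X)} (hE : MeasurableSet E) :
    ‖kernelOp μ E‖ ≤ (μ.prod μ).real E ^ (1 / 2 : ℝ) := by
  refine ContinuousLinearMap.opNorm_le_of_re_inner_le (by positivity) fun g f hg hf => ?_
  have h1 : ⟪f, kernelOp μ E g⟫_ℂ = ⟪indicatorConstLp 2 hE (measure_ne_top (μ.prod μ) E) (1 : ℂ),
      (memLp_tensor μ f g).toLp⟫_ℂ := by
    rw [inner_kernelOp, L2.inner_indicatorConstLp_one]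
    exact integral_congr_ae (ae_restrict_of_ae (memLp_tensor μ f g).coeFn_toLp.symm)
  rw [← inner_conj_symm, RCLike.conj_re, h1]
  refine (RCLike.re_le_norm _).trans ((norm_inner_le_norm _ _).trans ?_)
  rw [norm_toLp_tensor, hf, hg, norm_indicatorConstLp (by norm_num) (by norm_num)]
  simp

theorem kernelOp_diff {E F : Set (X × X)} (hE : MeasurableSet E) (h : E ⊆ F) :
    kernelOp μ (F \ E) = kernelOp μ F - kernelOp μ E := by
  ext1 g
  refine ext_inner_left ℂ fun f => ?_
  rw [sub_apply, inner_sub_right]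
  simp only [inner_kernelOp]
  exact setIntegral_sdiff hE (integrable_tensor μ f g).integrableOn h

theorem kernelOp_union {E F : Set (X × X)} (hF : MeasurableSet F)
    (h : Disjoint E F) : kernelOp μ (E ∪ F) = kernelOp μ E + kernelOp μ F := by
  ext1 g
  refine ext_inner_left ℂ fun f => ?_
  rw [add_apply, inner_add_right]
  simp only [inner_kernelOp]
  exact setIntegral_union h hF (integrable_tensor μ f g).integrableOn
    (integrable_tensor μ f g).integrableOn

/-- The indicator function of a measurable set, as an element of `L²(μ)`. -/
noncomputable abbrev indicatorL2 {s : Set X} (hs : MeasurableSet s) : Lp ℂ 2 μ :=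
  indicatorConstLp 2 hs (measure_ne_top μ s) 1

theorem kernelOp_prod {s t : Set X} (hs : MeasurableSet s) (ht : MeasurableSet t) :
    kernelOp μ (s ×ˢ t) =
      InnerProductSpace.rankOne ℂ (indicatorL2 μ hs) (indicatorL2 μ ht) := by
  ext1 g
  refine ext_inner_left ℂ fun f => ?_
  rw [inner_kernelOp, InnerProductSpace.rankOne_apply, inner_smul_right,
    L2.inner_indicatorConstLp_one, ← inner_conj_symm, L2.inner_indicatorConstLp_one,
    setIntegral_prod_mul (fun x => conj (f x)) (fun y => g y), ← integral_conj, mul_comm]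

theorem isCompactOperator_rankOne {H : Type*} [NormedAddCommGroup H] [InnerProductSpace ℂ H]
    (x y : H) : IsCompactOperator (InnerProductSpace.rankOne ℂ x y : H →L[ℂ] H) := by
  rw [InnerProductSpace.rankOne_def']
  exact ((isCompactOperator_id (E := ℂ)).comp_clm (innerSL ℂ y)).clm_comp
    (ContinuousLinearMap.toSpanSingleton ℂ x)

/-- Rectangles give rank one operators. Compactness survives differences and norm limits, hence
spreads to the generated σ-algebra by Dynkin induction. -/
theorem isCompactOperator_kernelOp {E : Set (X × X)} (hE : MeasurableSet E) :
    IsCompactOperator (kernelOp μ E) := by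
  induction E, hE using MeasurableSpace.induction_on_inter generateFrom_prod.symm isPiSystem_prod with
  | empty =>
    rw [← Set.prod_empty (s := Set.univ), kernelOp_prod μ .univ .empty]
    exact isCompactOperator_rankOne _ _
  | basic t ht =>
    obtain ⟨a, ha, b, hb, rfl⟩ := ht
    rw [kernelOp_prod μ ha hb]
    exact isCompactOperator_rankOne _ _
  | compl t htm h =>
    rw [Set.compl_eq_univ_sdiff, kernelOp_diff μ htm (Set.subset_univ _), ← Set.univ_prod_univ,
      kernelOp_prod μ .univ .univ]
    exact (isCompactOperator_rankOne _ _).sub h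
  | iUnion A hd hm h =>
    have hUm : ∀ n, MeasurableSet (⋃ i ∈ Finset.range n, A i) := fun n =>
      .biUnion (Finset.countable_toSet _) fun i _ => hm i
    have hfin : ∀ n, IsCompactOperator (kernelOp μ (⋃ i ∈ Finset.range n, A i)) := by
      intro n
      induction n with
      | zero =>
        simp only [Finset.range_zero, Finset.notMem_empty, Set.iUnion_of_empty, Set.iUnion_empty]
        rw [← Set.prod_empty (s := Set.univ), kernelOp_prod μ .univ .empty]
        exact isCompactOperator_rankOne _ _
      | succ n ih =>
        rw [Finset.range_add_one, Finset.set_biUnion_insert, kernelOp_union μ (hUm n)]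
        · exact (h n).add ih
        · simp only [Set.disjoint_iUnion_right, Finset.mem_range]
          exact fun i hi => hd hi.ne'
    refine isCompactOperator_of_tendsto (l := atTop) ?_ (Eventually.of_forall hfin)
    rw [tendsto_iff_norm_sub_tendsto_zero]
    have hlim : Tendsto (fun n => (μ.prod μ).real (⋃ i, ⋃ (_ : n ≤ i), A i) ^ (1 / 2 : ℝ)) atTop
        (nhds 0) := by
      have h0 := tendsto_measure_biUnion_Ici_zero_of_pairwise_disjoint (μ := μ.prod μ)
        (fun i => (hm i).nullMeasurableSet) hd
      have h1 := ((ENNReal.tendsto_toReal ENNReal.zero_ne_top).comp h0).rpow_const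
        (p := 1 / 2) (Or.inr (by norm_num))
      simpa [Measure.real] using h1
    refine squeeze_zero (fun _ => norm_nonneg _) (fun n => ?_) hlim
    have hsub : (⋃ i ∈ Finset.range n, A i) ⊆ ⋃ i, A i := by
      intro x hx
      simp only [Set.mem_iUnion] at hx ⊢
      obtain ⟨i, _, hi⟩ := hx
      exact ⟨i, hi⟩
    rw [norm_sub_rev, ← kernelOp_diff μ (hUm n) hsub]
    refine (norm_kernelOp_le μ ((MeasurableSet.iUnion hm).diff (hUm n))).trans ?_
    refine Real.rpow_le_rpow measureReal_nonneg (measureReal_mono ?_ (measure_ne_top _ _)) (by norm_num)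
    rintro x ⟨hx, hx'⟩
    simp only [Set.mem_iUnion, Finset.mem_range, not_exists] at hx hx' ⊢
    obtain ⟨i, hi⟩ := hx
    exact ⟨i, not_lt.1 fun hlt => hx' i hlt hi, hi⟩

end KernelOperator

/-! ### Common eigenvectors of a compact operator and an isometry -/

/-- A nonzero compact symmetric operator whose quadratic form is invariant under a linear isometry
`U` has an eigenvector of nonzero eigenvalue that is also an eigenvector of `U`. -/
theorem exists_common_eigenvector {H : Type*} [NormedAddCommGroup H] [InnerProductSpace ℂ H]
    [CompleteSpace H] {K : H →L[ℂ] H} (hK : IsCompactOperator K)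
    (hs : (K : H →ₗ[ℂ] H).IsSymmetric) (h0 : K ≠ 0) (U : H →ₗᵢ[ℂ] H)
    (hU : ∀ f, ⟪U f, K (U f)⟫_ℂ = ⟪f, K f⟫_ℂ) :
    ∃ (l z : ℂ) (f : H), l ≠ 0 ∧ f ≠ 0 ∧ K f = l • f ∧ U f = z • f := by
  have : Nontrivial H := by
    by_contra hn
    rw [not_nontrivial_iff_subsingleton] at hn
    exact h0 (ContinuousLinearMap.ext fun x => Subsingleton.elim _ _)
  obtain ⟨l, hl, hln⟩ := spectrum.exists_nnnorm_eq_spectralRadius K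
  have hsa : IsSelfAdjoint K := ContinuousLinearMap.isSelfAdjoint_iff_isSymmetric.2 hs
  rw [K.spectralRadius_eq_nnnorm hsa, ENNReal.coe_inj] at hln
  have hlK : ‖l‖ = ‖K‖ := congrArg NNReal.toReal hln
  have hl0 : l ≠ 0 := norm_pos_iff.1 (hlK ▸ norm_pos_iff.2 h0)
  have hev := (hK.hasEigenvalue_iff_mem_spectrum hl0).2 hl
  have hreal : conj l = l := hs.conj_eigenvalue_eq_self hev
  let V := Module.End.eigenspace (K : H →ₗ[ℂ] H) l
  have hfd : FiniteDimensional ℂ V := ContinuousLinearMap.finite_dimensional_eigenspace hK l hl0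
  -- Since `|l| = ‖K‖`, the invariant quadratic form is extremal at `U f`. Expanding `‖K (U f) - l •
  -- U f‖ ^ 2` then gives at most `0`. Commutation of `U` and `K` is not needed.
  have hinv : ∀ f ∈ V, U f ∈ V := by
    intro f hf
    have hf' : K f = l • f := Module.End.mem_eigenspace_iff.1 hf
    refine Module.End.mem_eigenspace_iff.2 (sub_eq_zero.1 (norm_eq_zero.1 ?_))
    have h1 : ⟪U f, K (U f)⟫_ℂ = l * (‖f‖ : ℂ) ^ 2 := by
      rw [hU, hf', inner_smul_right, inner_self_eq_norm_sq_to_K]; rfl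
    have h2 : ‖K (U f)‖ ≤ ‖l‖ * ‖f‖ := by
      rw [hlK, ← U.norm_map f]; exact K.le_opNorm _
    have h3 : RCLike.re ⟪K (U f), l • U f⟫_ℂ = ‖l‖ ^ 2 * ‖f‖ ^ 2 := by
      have h1' : ⟪K (U f), U f⟫_ℂ = l * (‖f‖ : ℂ) ^ 2 := by
        rw [← inner_conj_symm, h1, map_mul (starRingEnd ℂ), hreal, map_pow, Complex.conj_ofReal]
      rw [inner_smul_right, h1']
      have : l * (l * (‖f‖ : ℂ) ^ 2) = ((‖l‖ ^ 2 * ‖f‖ ^ 2 : ℝ) : ℂ) := by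
        push_cast
        rw [← Complex.mul_conj', hreal]; ring
      rw [this]; exact Complex.ofReal_re _
    have h4 := norm_sub_sq (𝕜 := ℂ) (K (U f)) (l • U f)
    rw [h3, norm_smul, U.norm_map] at h4
    have h5 : ‖K (U f)‖ ^ 2 ≤ (‖l‖ * ‖f‖) ^ 2 := pow_le_pow_left₀ (norm_nonneg _) h2 2
    have h6 : ‖K (U f) - l • U f‖ ^ 2 ≤ 0 := by nlinarith
    exact pow_eq_zero_iff two_ne_zero |>.1 (le_antisymm h6 (sq_nonneg _))
  have hnt : Nontrivial V := Submodule.nontrivial_iff_ne_bot.2 hev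
  obtain ⟨z, hz⟩ := Module.End.exists_eigenvalue (U.toLinearMap.restrict hinv)
  obtain ⟨v, hv⟩ := hz.exists_hasEigenvector
  refine ⟨l, z, v, hl0, fun h => hv.2 (Subtype.ext h), Module.End.mem_eigenspace_iff.1 v.2, ?_⟩
  exact congrArg Subtype.val hv.apply_eq_smul

/-! ### The zero-one law for symmetric invariant sets in the square -/

section ProductErgodicity

variable {X : Type u} [MeasurableSpace X] {μ : Measure X}

theorem isSymmetric_kernelOp [IsProbabilityMeasure μ] {E : Set (X × X)}
    (hsymm : Prod.swap ⁻¹' E = E) : (kernelOp μ E : Lp ℂ 2 μ →ₗ[ℂ] Lp ℂ 2 μ).IsSymmetric := by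
  intro f g
  change ⟪kernelOp μ E f, g⟫_ℂ = ⟪f, kernelOp μ E g⟫_ℂ
  rw [← inner_conj_symm, inner_kernelOp, inner_kernelOp, ← integral_conj]
  have := (Measure.measurePreserving_swap (μ := μ) (ν := μ)).setIntegral_preimage_emb
    MeasurableEquiv.prodComm.measurableEmbedding (fun p : X × X => conj (f p.1) * g p.2) E
  rw [← this, hsymm]
  refine integral_congr_ae (ae_of_all _ fun p => ?_)
  simp [mul_comm]

/-- Change of variables along `T × T`, which preserves both the product measure and `E`. With `T`
possibly noninvertible, this invariance of the form replaces commutation with the Koopman operator.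
-/
theorem inner_kernelOp_comp [IsProbabilityMeasure μ] {T : X → X} (hT : MeasurePreserving T μ μ)
    {E : Set (X × X)} (hE : MeasurableSet E) (hinv : Prod.map T T ⁻¹' E = E) (f g : Lp ℂ 2 μ) :
    ⟪Lp.compMeasurePreserving T hT f, kernelOp μ E (Lp.compMeasurePreserving T hT g)⟫_ℂ =
      ⟪f, kernelOp μ E g⟫_ℂ := by
  have hTT := hT.prod hT
  rw [inner_kernelOp, inner_kernelOp]
  have h : ∫ p in E, conj (f p.1) * g p.2 ∂(μ.prod μ) =
      ∫ p in E, conj (f (T p.1)) * g (T p.2) ∂(μ.prod μ) := by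
    conv_lhs => rw [← hTT.map_eq]
    rw [setIntegral_map hE _ hTT.measurable.aemeasurable, hinv]
    · rfl
    · rw [hTT.map_eq]
      exact (memLp_tensor μ f g).1
  rw [h]
  refine integral_congr_ae (ae_restrict_of_ae ?_)
  have hf := (Measure.quasiMeasurePreserving_fst (μ := μ) (ν := μ)).ae
    (Lp.coeFn_compMeasurePreserving f hT)
  have hg := (Measure.quasiMeasurePreserving_snd (μ := μ) (ν := μ)).ae
    (Lp.coeFn_compMeasurePreserving g hT)
  filter_upwards [hf, hg] with p hf hg
  rw [hf, hg]; rfl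

/-- For a weakly mixing transformation every `L²` eigenfunction is almost everywhere constant. -/
theorem IsWeaklyMixing.exists_ae_const_of_eigenvector [IsProbabilityMeasure μ] {T : X → X}
    (hT : Ergodic T μ) (hw : IsWeaklyMixing T μ) {f : Lp ℂ 2 μ} {z : ℂ}
    (hf : Lp.compMeasurePreserving T hT.toMeasurePreserving f = z • f) :
    ∃ c : ℂ, ∀ᵐ x ∂μ, f x = c := by
  by_cases hf0 : f = 0
  · refine ⟨0, ?_⟩
    rw [hf0]
    exact Lp.coeFn_zero ℂ 2 μ
  have hz : ‖z‖ = 1 := by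
    have h := Lp.norm_compMeasurePreserving f hT.toMeasurePreserving
    rw [hf, norm_smul] at h
    exact (mul_eq_right₀ (norm_ne_zero_iff.2 hf0)).1 h
  have heq : ∀ᵐ x ∂μ, f (T x) = z * f x := by
    have h1 := Lp.coeFn_compMeasurePreserving f hT.toMeasurePreserving
    rw [hf] at h1
    filter_upwards [h1, Lp.coeFn_smul z f] with x h1 h2
    rw [h2] at h1
    exact h1.symm
  -- The modulus is invariant, hence constant by ergodicity. So the `L²` eigenfunction is bounded
  -- and the definition of weak mixing applies.
  have hnorm : (fun x => ‖f x‖) ∘ T =ᵐ[μ] fun x => ‖f x‖ := by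
    filter_upwards [heq] with x hx
    simp [hx, hz]
  obtain ⟨r, hr⟩ := hT.ae_eq_const_of_ae_eq_comp_ae
    (Lp.aestronglyMeasurable f).norm hnorm
  exact hw f z (memLp_top_of_bound (Lp.aestronglyMeasurable f) r
    (hr.mono fun x hx => le_of_eq hx)) heq

/-- For a weakly mixing ergodic transformation, symmetric invariant subsets of the square are null
or conull (probability measure). -/
theorem IsWeaklyMixing.prod_null_or_conull_of_isProbabilityMeasure [IsProbabilityMeasure μ]
    {T : X → X} (hT : Ergodic T μ) (hw : IsWeaklyMixing T μ) {E : Set (X × X)}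
    (hE : MeasurableSet E) (hsymm : Prod.swap ⁻¹' E = E) (hinv : Prod.map T T ⁻¹' E = E) :
    μ.prod μ E = 0 ∨ μ.prod μ Eᶜ = 0 := by
  have hmeas : Measurable fun x => μ (Prod.mk x ⁻¹' E) := measurable_measure_prodMk_left hE
  -- Invariance of `E` makes the section over `x` the `T`-preimage of the section over `T x`. By
  -- ergodicity the section measure is a constant `c`, and constants are eigenvectors of the kernel
  -- operator.
  have hsec : (fun x => μ (Prod.mk x ⁻¹' E)) ∘ T = fun x => μ (Prod.mk x ⁻¹' E) := by
    funext x
    have h1 := hT.toMeasurePreserving.measure_preimage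
      (measurable_prodMk_left (x := T x) hE).nullMeasurableSet
    rw [Function.comp_apply, ← h1]
    refine congrArg μ ?_
    conv_rhs => rw [← hinv]
    rfl
  obtain ⟨c, hc⟩ := hT.ae_eq_const_of_ae_eq_comp₀ hmeas.nullMeasurable
    (Filter.EventuallyEq.of_eq hsec)
  have hctop : c ≠ ⊤ := by
    obtain ⟨x, hx⟩ := hc.exists
    exact (show μ (Prod.mk x ⁻¹' E) = c from hx) ▸ measure_ne_top μ _
  let U := Lp.compMeasurePreservingₗᵢ (E := ℂ) (p := 2) ℂ T hT.toMeasurePreserving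
  have hU1 : U (indicatorL2 μ MeasurableSet.univ) = indicatorL2 μ MeasurableSet.univ :=
    Lp.indicatorConstLp_compMeasurePreserving MeasurableSet.univ (measure_ne_top _ _) 1
      hT.toMeasurePreserving
  let e : Lp ℂ 2 μ := indicatorL2 μ MeasurableSet.univ
  -- Subtracting `c` times the projection onto constants yields the operator with kernel `1_E - c`,
  -- which kills `e`.
  let K : Lp ℂ 2 μ →L[ℂ] Lp ℂ 2 μ :=
    kernelOp μ E - (c.toReal : ℂ) • InnerProductSpace.rankOne ℂ e e
  have hKc : IsCompactOperator K :=
    (isCompactOperator_kernelOp μ hE).sub ((isCompactOperator_rankOne e e).smul (c.toReal : ℂ))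
  have hKi : ∀ f g, ⟪f, K g⟫_ℂ = ⟪f, kernelOp μ E g⟫_ℂ - c.toReal * (⟪e, g⟫_ℂ * ⟪f, e⟫_ℂ) := by
    intro f g
    simp only [K, sub_apply, smul_apply, inner_sub_right, inner_smul_right,
      InnerProductSpace.rankOne_apply]
  have hKs : (K : Lp ℂ 2 μ →ₗ[ℂ] Lp ℂ 2 μ).IsSymmetric := by
    intro f g
    change ⟪K f, g⟫_ℂ = ⟪f, K g⟫_ℂ
    have h1 : ⟪g, kernelOp μ E f⟫_ℂ = conj ⟪f, kernelOp μ E g⟫_ℂ := by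
      rw [inner_conj_symm]
      exact (isSymmetric_kernelOp hsymm g f).symm
    rw [← inner_conj_symm, hKi, hKi, h1]
    simp only [map_sub, map_mul, Complex.conj_ofReal, inner_conj_symm]
    ring
  have hK1 : K e = 0 := by
    refine ext_inner_left ℂ fun f => ?_
    have hfint : Integrable (fun p : X × X => conj (f p.1)) (μ.prod μ) :=
      (Complex.conjCLE.toContinuousLinearMap.integrable_comp
        ((Lp.memLp f).integrable (by norm_num))).comp_fst μ
    have h1 : ⟪f, kernelOp μ E e⟫_ℂ = ∫ p in E, conj (f p.1) ∂(μ.prod μ) := by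
      rw [inner_kernelOp]
      refine integral_congr_ae (ae_restrict_of_ae ?_)
      filter_upwards [(Measure.quasiMeasurePreserving_snd (μ := μ) (ν := μ)).ae
        (indicatorConstLp_coeFn (p := 2) (hs := MeasurableSet.univ) (hμs := measure_ne_top μ _)
          (c := (1 : ℂ)))] with p hp
      change conj (f p.1) * (indicatorL2 μ MeasurableSet.univ : Lp ℂ 2 μ) p.2 = _
      rw [hp]; simp
    have h2 : ∫ p in E, conj (f p.1) ∂(μ.prod μ) = c.toReal * ∫ x, conj (f x) ∂μ := by
      rw [← integral_indicator hE, integral_prod _ (hfint.indicator hE), ← integral_const_mul]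
      refine integral_congr_ae ?_
      filter_upwards [hc] with x hx
      have : ∀ y, E.indicator (fun p : X × X => conj (f p.1)) (x, y) =
          (Prod.mk x ⁻¹' E).indicator (fun _ => conj (f x)) y := fun y => rfl
      simp only [this]
      rw [integral_indicator (measurable_prodMk_left hE), setIntegral_const, Measure.real,
        (hx : μ _ = c)]
      rfl
    have h3 : ⟪f, e⟫_ℂ = ∫ x, conj (f x) ∂μ := by
      rw [← inner_conj_symm, L2.inner_indicatorConstLp_one, setIntegral_univ, integral_conj]
    have h4 : ⟪e, e⟫_ℂ = 1 := by
      rw [L2.inner_indicatorConstLp_one_indicatorConstLp_one]; simp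
    rw [hKi, h1, h2, h3, h4, inner_zero_right, one_mul, sub_self]
  -- Otherwise the common eigenvector is constant by weak mixing, yet orthogonal to `e` by symmetry
  -- of `K` and `K e = 0`; so it vanishes.
  have hK0 : K = 0 := by
    by_contra hne
    obtain ⟨l, z, f, hl, hf, hKf, hUf⟩ := exists_common_eigenvector hKc hKs hne U fun f => by
      have h1 : ⟪e, U f⟫_ℂ = ⟪e, f⟫_ℂ := by
        conv_lhs => rw [show e = U e from hU1.symm]
        exact U.inner_map_map e f
      have h2 : ⟪U f, e⟫_ℂ = ⟪f, e⟫_ℂ := by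
        conv_lhs => rw [show e = U e from hU1.symm]
        exact U.inner_map_map f e
      rw [hKi, hKi, h1, h2]
      congr 1
      exact inner_kernelOp_comp hT.toMeasurePreserving hE hinv f f
    obtain ⟨a, ha⟩ := hw.exists_ae_const_of_eigenvector hT hUf
    have h1 : l * ⟪e, f⟫_ℂ = 0 := by
      rw [← inner_smul_right, ← hKf]
      have := hKs e f
      change ⟪K e, f⟫_ℂ = ⟪e, K f⟫_ℂ at this
      rw [← this, hK1, inner_zero_left]
    have h2 : ⟪e, f⟫_ℂ = a := by
      rw [L2.inner_indicatorConstLp_one, setIntegral_univ, integral_congr_ae ha]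
      simp
    rw [h2] at h1
    have ha0 := (mul_eq_zero.1 h1).resolve_left hl
    refine hf (Lp.eq_zero_iff_ae_eq_zero.2 ?_)
    filter_upwards [ha] with x hx
    rw [hx, ha0]; rfl
  -- Vanishing of `K` on indicators says that the two measures agree on rectangles. Evaluating at
  -- `Eᶜ` then forces `c = 0` or `Eᶜ` null.
  have hres : (μ.prod μ).restrict E = c • μ.prod μ := by
    have : IsFiniteMeasure (c • μ.prod μ) := Measure.smul_finite _ hctop
    refine Measure.ext_prod fun {s t} hs ht => ?_
    have h1 := hKi (indicatorL2 μ hs) (indicatorL2 μ ht)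
    rw [hK0, zero_apply, inner_zero_right, L2.inner_indicatorConstLp_one_indicatorConstLp_one,
      L2.inner_indicatorConstLp_one_indicatorConstLp_one, inner_kernelOp] at h1
    have h2 : ∫ p in E, conj ((indicatorL2 μ hs : Lp ℂ 2 μ) p.1) *
        (indicatorL2 μ ht : Lp ℂ 2 μ) p.2 ∂(μ.prod μ) =
        ∫ p in E, (s ×ˢ t).indicator (fun _ => (1 : ℂ)) p ∂(μ.prod μ) := by
      refine integral_congr_ae (ae_restrict_of_ae ?_)
      filter_upwards [(Measure.quasiMeasurePreserving_fst (μ := μ) (ν := μ)).ae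
        (indicatorConstLp_coeFn (p := 2) (hs := hs) (hμs := measure_ne_top μ _) (c := (1 : ℂ))),
        (Measure.quasiMeasurePreserving_snd (μ := μ) (ν := μ)).ae
        (indicatorConstLp_coeFn (p := 2) (hs := ht) (hμs := measure_ne_top μ _) (c := (1 : ℂ)))]
        with p hp hq
      rw [hp, hq]
      by_cases h1 : p.1 ∈ s <;> by_cases h2 : p.2 ∈ t <;> simp [Set.indicator, h1, h2]
    rw [h2, integral_indicator (hs.prod ht), setIntegral_const, Set.univ_inter, Set.inter_univ,
      eq_comm, sub_eq_zero] at h1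
    have h3 : ((μ.prod μ).restrict E).real (s ×ˢ t) = c.toReal * (μ.real t * μ.real s) := by
      have : ((((μ.prod μ).restrict E).real (s ×ˢ t) : ℝ) : ℂ) =
          ((c.toReal * (μ.real t * μ.real s) : ℝ) : ℂ) := by
        push_cast
        simpa using h1
      exact_mod_cast this
    rw [← ENNReal.toReal_eq_toReal_iff' (measure_ne_top _ _) (measure_ne_top _ _)]
    change ((μ.prod μ).restrict E).real (s ×ˢ t) = _
    rw [h3, Measure.smul_apply, Measure.prod_prod, smul_eq_mul, ENNReal.toReal_mul,
      ENNReal.toReal_mul, mul_comm (μ.real t)]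
    rfl
  have h0 : c * μ.prod μ Eᶜ = 0 := by
    have h := congrArg (fun ν => ν Eᶜ) hres
    simpa [hE.compl] using h.symm
  rcases mul_eq_zero.1 h0 with h0 | h0
  · left
    have h := congrArg (fun ν => ν Set.univ) hres
    simpa [h0] using h
  · exact Or.inr h0

/-- For a weakly mixing ergodic transformation, symmetric invariant subsets of the square are null
or conull. -/
theorem IsWeaklyMixing.prod_null_or_conull [IsFiniteMeasure μ]
    {T : X → X} (hT : Ergodic T μ) (hw : IsWeaklyMixing T μ) {E : Set (X × X)}
    (hE : MeasurableSet E) (hsymm : Prod.swap ⁻¹' E = E) (hinv : Prod.map T T ⁻¹' E = E) :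
    μ.prod μ E = 0 ∨ μ.prod μ Eᶜ = 0 := by
  rcases eq_or_ne μ 0 with rfl | h0
  · left; simp
  have : NeZero μ := ⟨h0⟩
  let c := (μ Set.univ)⁻¹
  have hc0 : c ≠ 0 := ENNReal.inv_ne_zero.2 (measure_ne_top _ _)
  have hctop : c ≠ ⊤ := ENNReal.inv_ne_top.2 (NeZero.ne _)
  have hae : ∀ p : X → Prop, (∀ᵐ x ∂(c • μ), p x) ↔ ∀ᵐ x ∂μ, p x := fun p =>
    by rw [Measure.ae_ennreal_smul_measure_eq hc0]
  have hw' : IsWeaklyMixing T (c • μ) := by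
    intro f z hf hz
    obtain ⟨a, ha⟩ := hw f z
      (hf.of_measure_le_smul (c := c⁻¹) (ENNReal.inv_ne_top.2 hc0)
        (by rw [smul_smul, ENNReal.inv_mul_cancel hc0 hctop, one_smul])) ((hae _).1 hz)
    exact ⟨a, (hae _).2 ha⟩
  have h := hw'.prod_null_or_conull_of_isProbabilityMeasure (hT.smul_measure c) hE hsymm hinv
  have hprod : ∀ A, (c • μ).prod (c • μ) A = 0 → μ.prod μ A = 0 := by
    intro A hA
    rw [Measure.prod_smul_left, Measure.prod_smul_right, Measure.smul_apply, Measure.smul_apply,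
      smul_eq_mul, smul_eq_mul] at hA
    exact ((mul_eq_zero.1 hA).resolve_left hc0 |> mul_eq_zero.1).resolve_left hc0
  exact h.imp (hprod E) (hprod Eᶜ)

end ProductErgodicity

/-! ### Elementary properties of compatible metrics -/

namespace IsCompatibleMetric

variable {X : Type u} [MeasurableSpace X] {μ : Measure X} {d : X → X → ℝ}

theorem self_eq_zero (hd : IsCompatibleMetric μ d) (x : X) : d x x = 0 :=
  (hd.eq_zero_iff x x).2 rfl

theorem nonneg (hd : IsCompatibleMetric μ d) (x y : X) : 0 ≤ d x y := by
  have h := hd.triangle x y x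
  rw [hd.self_eq_zero, hd.symm y x] at h
  linarith

theorem measurableSet_ball (hd : IsCompatibleMetric μ d) (x : X) (r : ℝ) :
    MeasurableSet {y | d x y < r} :=
  measurableSet_lt (hd.measurable.comp measurable_prodMk_left) measurable_const

theorem isCoboundedUnder_ge (hd : IsCompatibleMetric μ d) (u v : ℕ → X) :
    IsCoboundedUnder (· ≥ ·) atTop fun n => d (u n) (v n) :=
  (isBoundedUnder_of ⟨1, fun _ => hd.le_one _ _⟩ :
    IsBoundedUnder (· ≤ ·) atTop fun n => d (u n) (v n)).isCoboundedUnder_ge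

theorem isBoundedUnder_ge (hd : IsCompatibleMetric μ d) (u v : ℕ → X) :
    IsBoundedUnder (· ≥ ·) atTop fun n => d (u n) (v n) :=
  isBoundedUnder_of ⟨0, fun _ => hd.nonneg _ _⟩

theorem isBoundedUnder_le (hd : IsCompatibleMetric μ d) (u v : ℕ → X) :
    IsBoundedUnder (· ≤ ·) atTop fun n => d (u n) (v n) :=
  isBoundedUnder_of ⟨1, fun _ => hd.le_one _ _⟩

end IsCompatibleMetric

/-! ### From weak mixing to Li-Yorke sensitivity -/

section WeakMixing

variable {X : Type u} [MeasurableSpace X] {μ : Measure X} [IsFiniteMeasure μ] {T : X → X}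

/-- For a weakly mixing ergodic transformation, almost every orbit in the square visits a symmetric
set of positive measure infinitely often. -/
theorem IsWeaklyMixing.ae_frequently_mem (hT : Ergodic T μ) (hw : IsWeaklyMixing T μ)
    {s : Set (X × X)} (hs : MeasurableSet s) (hsymm : ∀ p, p.swap ∈ s ↔ p ∈ s)
    (h0 : μ.prod μ s ≠ 0) :
    ∀ᵐ p ∂(μ.prod μ), ∃ᶠ n in atTop, (T^[n] p.1, T^[n] p.2) ∈ s := by
  have hTT := hT.toMeasurePreserving.prod hT.toMeasurePreserving
  have hit : ∀ (n : ℕ) (p : X × X), (Prod.map T T)^[n] p = (T^[n] p.1, T^[n] p.2) := by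
    intro n p
    rw [Prod.map_iterate]; rfl
  let E : Set (X × X) := {p | ∃ᶠ n in atTop, (T^[n] p.1, T^[n] p.2) ∈ s}
  have hE : MeasurableSet E := by
    have : E = limsup (fun n => (Prod.map T T)^[n] ⁻¹' s) atTop := by
      ext p
      rw [Filter.limsup_eq_iInf_iSup_of_nat]
      simp only [E, frequently_atTop, Set.mem_ofPred_eq, Set.iInf_eq_iInter, Set.iSup_eq_iUnion, Set.mem_iInter, Set.mem_iUnion, Set.mem_preimage, hit, exists_prop, ge_iff_le]
    rw [this]
    exact MeasurableSet.measurableSet_limsup fun n => hTT.measurable.iterate n hs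
  have hEs : Prod.swap ⁻¹' E = E := by
    ext p
    exact frequently_congr (Eventually.of_forall fun n => hsymm (T^[n] p.1, T^[n] p.2))
  -- Visiting infinitely often is insensitive to an index shift, so invariance is exact.
  have hEi : Prod.map T T ⁻¹' E = E := by
    ext p
    change (∃ᶠ n in atTop, (T^[n] (T p.1), T^[n] (T p.2)) ∈ s) ↔
      ∃ᶠ n in atTop, (T^[n] p.1, T^[n] p.2) ∈ s
    conv_rhs => rw [← map_add_atTop_eq_nat 1, frequently_map]
    rfl
  -- Poincaré recurrence puts almost all of `s` inside `E`.
  have hE0 : μ.prod μ E ≠ 0 := by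
    have h1 := hTT.conservative.ae_mem_imp_frequently_image_mem hs.nullMeasurableSet
    intro h2
    refine h0 (measure_mono_null_ae ?_ h2)
    filter_upwards [h1] with p hp hps
    have := hp hps
    simp only [hit] at this
    exact this
  exact (hw.prod_null_or_conull hT hE hEs hEi).resolve_left hE0

theorem IsCompatibleMetric.prod_setOf_lt_ne_zero {d : X → X → ℝ} (hd : IsCompatibleMetric μ d)
    [NeZero μ] {r : ℝ} (hr : 0 < r) : μ.prod μ {p | d p.1 p.2 < r} ≠ 0 := by
  intro h
  rw [Measure.measure_prod_null (measurableSet_lt hd.measurable measurable_const)] at h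
  obtain ⟨x, hx⟩ := h.exists
  exact (hd.ball_pos x r hr).ne' hx

/-- Otherwise, for some `x`, almost every `y` is at distance zero from `x`, and `μ` would be
concentrated on a point. -/
theorem IsCompatibleMetric.exists_prod_setOf_gt_ne_zero {d : X → X → ℝ}
    (hd : IsCompatibleMetric μ d) [NeZero μ] [NullSingletonClass μ] :
    ∃ r > 0, μ.prod μ {p | r < d p.1 p.2} ≠ 0 := by
  by_contra! h
  have h1 : ∀ᵐ p ∂(μ.prod μ), ∀ k : ℕ, ¬ (1 / ((k : ℝ) + 1) < d p.1 p.2) :=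
    ae_all_iff.2 fun k => measure_eq_zero_iff_ae_notMem.1 (h _ Nat.one_div_pos_of_nat)
  obtain ⟨x, hx⟩ := (Measure.ae_ae_of_ae_prod h1).exists
  refine NeZero.ne μ (Measure.measure_univ_eq_zero.1 ?_)
  refine measure_mono_null_ae ?_ (measure_singleton (μ := μ) x)
  filter_upwards [hx] with y hy _
  refine ((hd.eq_zero_iff x y).1 (le_antisymm (not_lt.1 fun hlt => ?_) (hd.nonneg x y))).symm
  obtain ⟨k, hk⟩ := exists_nat_one_div_lt hlt
  exact hy k hk

/-- Weakly mixing ergodic transformations of nonatomic spaces are Li-Yorke M-sensitive. -/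
theorem IsWeaklyMixing.isLiYorkeMSensitive [NullSingletonClass μ] (hT : Ergodic T μ)
    (hw : IsWeaklyMixing T μ) : IsLiYorkeMSensitive T μ := by
  intro d hd
  rcases eq_or_ne μ 0 with rfl | h0
  · simp
  have : NeZero μ := ⟨h0⟩
  obtain ⟨r, hr, hr0⟩ := hd.exists_prod_setOf_gt_ne_zero
  have h1 : ∀ᵐ p ∂(μ.prod μ), ∀ k : ℕ, ∃ᶠ n in atTop,
      d (T^[n] p.1) (T^[n] p.2) < 1 / ((k : ℝ) + 1) :=
    ae_all_iff.2 fun k => hw.ae_frequently_mem hT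
      (s := {p | d p.1 p.2 < 1 / ((k : ℝ) + 1)}) (measurableSet_lt hd.measurable measurable_const)
      (fun p => by simp [hd.symm p.2 p.1]) (hd.prod_setOf_lt_ne_zero Nat.one_div_pos_of_nat)
  have h2 := hw.ae_frequently_mem hT (s := {p | r < d p.1 p.2})
    (measurableSet_lt measurable_const hd.measurable) (fun p => by simp [hd.symm p.2 p.1]) hr0
  filter_upwards [h1, h2] with p hp1 hp2
  constructor
  · refine le_antisymm (le_of_forall_pos_lt_add fun ε hε => ?_) ?_
    · obtain ⟨k, hk⟩ := exists_nat_one_div_lt hε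
      rw [zero_add]
      exact (liminf_le_of_frequently_le ((hp1 k).mono fun n hn => hn.le)
        (hd.isBoundedUnder_ge _ _)).trans_lt hk
    · exact le_liminf_of_le (hd.isCoboundedUnder_ge _ _)
        (Eventually.of_forall fun n => hd.nonneg _ _)
  · exact hr.trans_le (le_limsup_of_frequently_le (hp2.mono fun n hn => le_of_lt hn)
      (hd.isBoundedUnder_le _ _))

end WeakMixing

/-! ### Rotation factors from eigenfunctions -/

/-- A measurable map that semiconjugates almost everywhere is a factor map onto its image
measure. -/
theorem isFactorMap_map {X Y : Type u} [MeasurableSpace X] [MeasurableSpace Y] {T : X → X}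
    {μ : Measure X} {S : Y → Y} {π : X → Y} (hT : MeasurePreserving T μ μ) (hS : Measurable S)
    (hπ : Measurable π) (h : ∀ᵐ x ∂μ, π (T x) = S (π x)) : IsFactorMap T μ S (μ.map π) π where
  base := ⟨hS, by
    rw [Measure.map_map hS hπ, ← Measure.map_congr (f := π ∘ T) (g := S ∘ π) h,
      ← Measure.map_map hπ hT.measurable, hT.map_eq]⟩
  map := ⟨hπ, rfl⟩
  equivariant := h

theorem min_one_le_add {a b c : ℝ} (ha : 0 ≤ a) (hb : 0 ≤ b) (h : c ≤ a + b) :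
    min 1 c ≤ min 1 a + min 1 b := by
  rcases min_choice 1 a with h3 | h3 <;> rcases min_choice 1 b with h4 | h4 <;> rw [h3, h4]
  · exact (min_le_left _ _).trans (by norm_num)
  · exact (min_le_left _ _).trans (by linarith)
  · exact (min_le_left _ _).trans (by linarith)
  · exact (min_le_right _ _).trans h

/-- The truncation at `1` of the metric pulled back along an injective measurable map whose values
lie in the support of the image measure is compatible. -/
theorem isCompatibleMetric_min_dist {Y : Type u} [MeasurableSpace Y] {ν : Measure Y}
    {E : Type*} [MetricSpace E] [SecondCountableTopology E] [MeasurableSpace E] [BorelSpace E]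
    {i : Y → E} (hi : Measurable i) (hinj : Function.Injective i)
    (hsupp : ∀ y, i y ∈ (ν.map i).support) :
    IsCompatibleMetric ν fun x y => min 1 (dist (i x) (i y)) where
  eq_zero_iff x y := by
    constructor
    · intro h
      rcases min_choice 1 (dist (i x) (i y)) with h1 | h1
      · rw [h1] at h; norm_num at h
      · rw [h1] at h; exact hinj (dist_eq_zero.1 h)
    · rintro rfl; simp
  symm x y := by rw [dist_comm]
  triangle x y z := min_one_le_add dist_nonneg dist_nonneg (dist_triangle _ _ _)
  le_one x y := min_le_left _ _
  measurable := measurable_const.min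
    ((hi.comp measurable_fst).dist (hi.comp measurable_snd))
  ball_pos x r hr := by
    have h := (Measure.mem_support_iff_forall (i x)).1 (hsupp x) _ (Metric.ball_mem_nhds (i x) hr)
    rw [Measure.map_apply hi Metric.isOpen_ball.measurableSet] at h
    refine h.trans_le (measure_mono fun y hy => ?_)
    rw [Set.mem_preimage, Metric.mem_ball, dist_comm] at hy
    exact (min_le_right _ _).trans_lt hy

/-- The eigenvalue of a nonzero bounded eigenfunction has modulus one. -/
theorem norm_eigenvalue_eq_one {X : Type u} [MeasurableSpace X] {μ : Measure X} {T : X → X}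
    (hT : MeasurePreserving T μ μ) {f : X → ℂ} {z : ℂ} (hf : MemLp f ⊤ μ)
    (h : ∀ᵐ x ∂μ, f (T x) = z * f x) (h0 : ¬ f =ᵐ[μ] 0) : ‖z‖ = 1 := by
  have h1 : eLpNorm (f ∘ T) ⊤ μ = eLpNorm f ⊤ μ := eLpNorm_comp_measurePreserving hf.1 hT
  have h2 : eLpNorm (f ∘ T) ⊤ μ = ‖z‖ₑ * eLpNorm f ⊤ μ := by
    rw [eLpNorm_congr_ae (f := f ∘ T) (g := z • f) h, eLpNorm_const_smul]
  have h3 : eLpNorm f ⊤ μ ≠ 0 := fun h => h0 ((eLpNorm_eq_zero_iff hf.1 ENNReal.top_ne_zero).1 h)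
  rw [h1, eq_comm, ENNReal.mul_eq_right h3 hf.2.ne] at h2
  simpa using congrArg ENNReal.toReal h2

/-- A transformation that is not weakly mixing has a nontrivial isometric factor: a rotation of
the plane, restricted to the support of the distribution of an eigenfunction. -/
theorem hasNontrivialIsometricFactor_of_not_isWeaklyMixing {X : Type u} [MeasurableSpace X]
    {μ : Measure X} {T : X → X} (hT : MeasurePreserving T μ μ) (hw : ¬ IsWeaklyMixing T μ) :
    HasNontrivialIsometricFactor T μ := by
  unfold IsWeaklyMixing at hw
  push Not at hw
  obtain ⟨f, z, hf, hfz, hne⟩ := hw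
  have hz : ‖z‖ = 1 := norm_eigenvalue_eq_one hT hf hfz fun h =>
    hne 0 (h.mono fun x hx => not_not.2 hx)
  let g := hf.1.mk f
  have hg : Measurable g := hf.1.stronglyMeasurable_mk.measurable
  have hfg : f =ᵐ[μ] g := hf.1.ae_eq_mk
  have hgz : ∀ᵐ x ∂μ, g (T x) = z * g x := by
    filter_upwards [hfz, hfg, hT.quasiMeasurePreserving.ae hfg] with x h1 h2 h3
    rw [← h2, ← h3, h1]
  -- Restricting to the support makes every ball have positive measure.
  let s := (μ.map g).support
  have hs : IsClosed s := Measure.isClosed_support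
  have hμs : ∀ᵐ x ∂μ, g x ∈ s := ae_of_ae_map hg.aemeasurable Measure.support_mem_ae
  -- The distribution of `g` is invariant under multiplication by `z`, hence its support is mapped
  -- into itself.
  have hsz : ∀ y ∈ s, z * y ∈ s := by
    intro y hy
    rw [Measure.mem_support_iff_forall] at hy ⊢
    intro U hU
    obtain ⟨V, hVU, hV, hyV⟩ := mem_nhds_iff.1 hU
    have hcont : Continuous fun w : ℂ => z * w := by fun_prop
    have h1 := hy _ ((hV.preimage hcont).mem_nhds hyV)
    have h2 : (μ.map g).map (fun w => z * w) = μ.map g := by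
      rw [Measure.map_map hcont.measurable hg, ← Measure.map_congr (f := g ∘ T) (g := (fun w => z * w) ∘ g) hgz,
        ← Measure.map_map hg hT.measurable, hT.map_eq]
    rw [← Measure.map_apply hcont.measurable hV.measurableSet, h2] at h1
    exact h1.trans_le (measure_mono hVU)
  have hsne : s.Nonempty := by
    have : NeZero μ := ⟨fun h => hne 0 (by simp [h])⟩
    obtain ⟨x, hx⟩ := hμs.exists
    exact ⟨_, hx⟩
  have : PolishSpace s := hs.polishSpace
  -- The lift moves a subset of `ℂ` into the universe of `X`.
  let Y := ULift.{u} s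
  have : PolishSpace Y := Homeomorph.ulift.isClosedEmbedding.polishSpace
  let i : Y → ℂ := fun y => (y.down : ℂ)
  have hi : MeasurableEmbedding i :=
    (MeasurableEmbedding.subtype_coe hs.measurableSet).comp
      MeasurableEquiv.ulift.measurableEmbedding
  -- `g` lands in `s` only almost everywhere; a measurable left inverse `r` of `i` defines the
  -- factor map on all of `X`.
  obtain ⟨r, hr, hri⟩ := hi.exists_measurable_extend measurable_id
    fun _ => ⟨ULift.up ⟨_, hsne.some_mem⟩⟩
  let π : X → Y := r ∘ g
  have hπ : Measurable π := hr.comp hg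
  have hiπ : ∀ᵐ x ∂μ, i (π x) = g x := by
    filter_upwards [hμs] with x hx
    exact congrArg i (congrFun hri (ULift.up ⟨g x, hx⟩))
  have hmap : (μ.map π).map i = μ.map g := by
    rw [Measure.map_map hi.measurable hπ]
    exact Measure.map_congr hiπ
  let S : Y → Y := fun y => ULift.up ⟨z * i y, hsz _ y.down.2⟩
  have hiS : ∀ y, i (S y) = z * i y := fun y => rfl
  have hS : Measurable S := by
    refine measurable_up.comp (Measurable.subtype_mk ?_)
    exact hi.measurable.const_mul z
  refine ⟨Y, inferInstance, inferInstance, μ.map π, S, π, isFactorMap_map hT hS hπ ?_, ?_,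
    fun x y => min 1 (dist (i x) (i y)), isCompatibleMetric_min_dist hi.measurable hi.injective ?_,
    ?_⟩
  · filter_upwards [hiπ, hT.quasiMeasurePreserving.ae hiπ, hgz] with x h1 h2 h3
    refine hi.injective ?_
    rw [hiS, h1, h2, h3]
  · by_contra hcon
    unfold IsNontrivialMeasure at hcon
    push Not at hcon
    -- If all measurable sets are null or conull, `g` is a.e. constant.
    obtain ⟨c, hc⟩ := exists_eventuallyEq_const_of_forall_separating (l := ae μ) (f := g)
      MeasurableSet fun U hU => by
        have key : ∀ V, MeasurableSet V → (μ.map π) (i ⁻¹' V) = μ (g ⁻¹' V) := fun V hV => by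
          rw [← Measure.map_apply hi.measurable hV, hmap, Measure.map_apply hg hV]
        by_cases h0 : (μ.map π) (i ⁻¹' U) = 0
        · right
          rw [key U hU] at h0
          exact measure_eq_zero_iff_ae_notMem.1 h0
        · left
          have h1 := hcon _ (hi.measurable hU) h0
          rw [← Set.preimage_compl, key _ hU.compl] at h1
          filter_upwards [measure_eq_zero_iff_ae_notMem.1 h1] with x hx
          exact not_not.1 hx
    exact hne c ((hfg.trans hc).mono fun x hx => not_not.2 hx)
  · intro y
    rw [hmap]
    exact y.down.2
  · intro x y
    simp only [hiS, Complex.dist_eq, ← mul_sub, norm_mul, hz, one_mul]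

/-! ### Lifting compatible metrics from a factor -/

/-- A compatible metric is separable. -/
theorem IsCompatibleMetric.exists_countable_cover {Y : Type u} [MeasurableSpace Y] {ν : Measure Y}
    [SFinite ν] {d : Y → Y → ℝ} (hd : IsCompatibleMetric ν d) {r : ℝ} (hr : 0 < r) :
    ∃ s : Set Y, s.Countable ∧ ∀ y, ∃ c ∈ s, d c y < r := by
  -- A maximal `r`-separated set works: its half-radius balls are disjoint with positive measure,
  -- hence countably many, and maximality gives the covering.
  obtain ⟨m, hm⟩ := zorn_subset {s : Set Y | s.Pairwise fun a b => r ≤ d a b} fun c hc hchain =>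
    ⟨⋃₀ c, (Set.pairwise_sUnion hchain.directedOn).2 fun s hs => hc hs,
      fun s hs => Set.subset_sUnion_of_mem hs⟩
  refine ⟨m, ?_, fun y => ?_⟩
  · have hdisj : Pairwise (Function.onFun Disjoint fun a : m => {y | d a y < r / 2}) := by
      intro a b hab
      refine Set.disjoint_left.2 fun y (hay : d a y < r / 2) (hby : d b y < r / 2) => ?_
      have h1 := hm.1 a.2 b.2 fun h => hab (Subtype.ext h)
      have h2 := hd.triangle a y b
      rw [hd.symm y b] at h2
      linarith
    have h := Measure.countable_meas_pos_of_disjoint_iUnion (μ := ν)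
      (fun a : m => hd.measurableSet_ball a (r / 2)) hdisj
    rw [Set.eq_univ_of_forall (s := {a : m | 0 < ν {y | d a y < r / 2}})
      fun a => hd.ball_pos _ _ (half_pos hr), Set.countable_univ_iff] at h
    exact h
  · by_contra! hy
    have hym : y ∉ m := fun h => by
      have := hy y h
      rw [hd.self_eq_zero] at this
      linarith
    have hins : (insert y m).Pairwise fun a b => r ≤ d a b := by
      refine Set.pairwise_insert.2 ⟨hm.1, fun b hb _ => ⟨?_, hy b hb⟩⟩
      rw [hd.symm]
      exact hy b hb
    exact hym (hm.2 hins (Set.subset_insert y m) (Set.mem_insert y m))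

/-- In a nonatomic standard Borel space, every conull Borel set contains the image of an injective
Borel map that is almost everywhere the identity. -/
theorem exists_injective_into_conull {X : Type u} [MeasurableSpace X] [StandardBorelSpace X]
    {μ : Measure X} [SFinite μ] [NullSingletonClass μ] [NeZero μ] {s : Set X}
    (hs : MeasurableSet s) (hsc : ∀ᵐ x ∂μ, x ∈ s) :
    ∃ φ : X → X, Measurable φ ∧ Function.Injective φ ∧ (∀ x, φ x ∈ s) ∧ ∀ᵐ x ∂μ, φ x = x := by
  have : StandardBorelSpace s := hs.standardBorel
  have hunc : ¬ Countable s := by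
    intro h
    refine NeZero.ne μ (Measure.measure_univ_eq_zero.1 ?_)
    exact measure_mono_null_ae (hsc.mono fun x hx _ => hx)
      ((Set.countable_coe_iff.1 h).measure_zero μ)
  have hunc2 : ¬ Countable (ℝ × ℝ) := by
    intro h
    exact Cardinal.not_countable_real (Set.countable_univ_iff.2
      (Function.Injective.countable (f := fun x : ℝ => (x, (0 : ℝ))) fun a b h => by simpa using h))
  let e : s ≃ᵐ ℝ × ℝ := PolishSpace.measurableEquivOfNotCountable hunc hunc2
  obtain ⟨e', he', hee⟩ := (MeasurableEmbedding.subtype_coe hs).exists_measurable_extend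
    e.measurable fun _ => inferInstance
  -- Only countably many vertical lines of `ℝ × ℝ` carry mass. A null line has room for a Borel copy
  -- of all of `X`; off it, points of `s` can stay fixed.
  obtain ⟨a, ha⟩ : ∃ a : ℝ, μ {x | (e' x).1 = a} = 0 := by
    by_contra! h
    refine Cardinal.not_countable_real
      ((Measure.countable_meas_level_set_pos (μ := μ) he'.fst).mono fun a _ => ?_)
    exact pos_iff_ne_zero.2 (h a)
  let t : Set X := {x | (e' x).1 = a}
  have ht : MeasurableSet t := he'.fst (measurableSet_singleton a)
  let j : X → X := fun x => e.symm (a, embeddingReal X x)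
  have hj : Measurable j :=
    measurable_subtype_coe.comp (e.symm.measurable.comp
      (measurable_const.prodMk (measurable_embeddingReal X)))
  have hjinj : Function.Injective j := by
    intro x y h
    have h1 := e.symm.injective (Subtype.ext h)
    exact (measurableEmbedding_embeddingReal X).injective (Prod.ext_iff.1 h1).2
  have hjs : ∀ x, j x ∈ s := fun x => (e.symm (a, embeddingReal X x)).2
  have hjt : ∀ x, j x ∈ t := by
    intro x
    have := congrFun hee (e.symm (a, embeddingReal X x))
    change (e' (e.symm (a, embeddingReal X x))).1 = a
    rw [Function.comp_apply] at this
    rw [this, e.apply_symm_apply]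
  classical
  let φ : X → X := (s \ t).piecewise id j
  have h1 : ∀ x ∈ s \ t, φ x = x := fun x hx => Set.piecewise_eq_of_mem _ _ _ hx
  have h2 : ∀ x, x ∉ s \ t → φ x = j x := fun x hx => Set.piecewise_eq_of_notMem _ _ _ hx
  refine ⟨φ, measurable_id.piecewise (hs.diff ht) hj, ?_, ?_, ?_⟩
  · intro x y hxy
    by_cases hx : x ∈ s \ t <;> by_cases hy : y ∈ s \ t
    · rwa [h1 x hx, h1 y hy] at hxy
    · rw [h1 x hx, h2 y hy] at hxy
      exact absurd (hxy ▸ hjt y) hx.2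
    · rw [h2 x hx, h1 y hy] at hxy
      exact absurd (hxy ▸ hjt x) hy.2
    · rw [h2 x hx, h2 y hy] at hxy
      exact hjinj hxy
  · intro x
    by_cases hx : x ∈ s \ t
    · rw [h1 x hx]; exact hx.1
    · rw [h2 x hx]; exact hjs x
  · filter_upwards [hsc, measure_eq_zero_iff_ae_notMem.1 ha] with x hx hxt
    exact h1 x ⟨hx, hxt⟩

/-- A compatible metric on a factor of a nonatomic space is dominated, up to a factor `2` and
outside a null set, by a compatible metric on the space. -/
theorem IsCompatibleMetric.exists_lift {X Y : Type u} [MeasurableSpace X] [StandardBorelSpace X]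
    [MeasurableSpace Y] {μ : Measure X} [SFinite μ] [NullSingletonClass μ] [NeZero μ]
    {ν : Measure Y} [SFinite ν] {d : Y → Y → ℝ} (hd : IsCompatibleMetric ν d) {π : X → Y}
    (hπ : Measurable π) :
    ∃ (D : X → X → ℝ) (φ : X → X), IsCompatibleMetric μ D ∧ (∀ᵐ x ∂μ, φ x = x) ∧
      ∀ x y, d (π (φ x)) (π (φ y)) / 2 ≤ D x y := by
  let e := embeddingReal X
  have he : Measurable e := measurable_embeddingReal X
  have heinj : Function.Injective e := (measurableEmbedding_embeddingReal X).injective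
  -- The real embedding separates points with equal image under `π`; the halves keep the sum bounded
  -- by `1`.
  let ρ : X → X → ℝ := fun x y => d (π x) (π y) / 2 + min 1 |e x - e y| / 2
  have hmin : ∀ x y, 0 ≤ min 1 |e x - e y| := fun x y => le_min zero_le_one (abs_nonneg _)
  have hρm : Measurable fun p : X × X => ρ p.1 p.2 := by
    have h1 : Measurable fun p : X × X => d (π p.1) (π p.2) :=
      hd.measurable.comp ((hπ.comp measurable_fst).prodMk (hπ.comp measurable_snd))
    have h2 : Measurable fun p : X × X => |e p.1 - e p.2| :=
      ((he.comp measurable_fst).sub (he.comp measurable_snd)).abs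
    exact (h1.div_const 2).add ((measurable_const.min h2).div_const 2)
  have hball : ∀ x r, MeasurableSet {y | ρ x y < r} := fun x r =>
    measurableSet_lt (hρm.comp measurable_prodMk_left) measurable_const
  let s : Set X := {x | ∀ k : ℕ, 0 < μ {y | ρ x y < 1 / ((k : ℝ) + 1)}}
  have hs : MeasurableSet s := by
    have : s = ⋂ k : ℕ, {x | 0 < μ {y | ρ x y < 1 / ((k : ℝ) + 1)}} := by ext; simp [s]
    rw [this]
    exact .iInter fun k => measurableSet_lt measurable_const
      (measurable_measure_prodMk_left
        (measurableSet_lt hρm (measurable_const (a := 1 / ((k : ℝ) + 1)))))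
  have hsc : ∀ᵐ x ∂μ, x ∈ s := by
    refine ae_all_iff.2 fun k => ?_
    have hr : 0 < 1 / ((k : ℝ) + 1) := Nat.one_div_pos_of_nat
    generalize 1 / ((k : ℝ) + 1) = r at hr
    obtain ⟨c, hc, hcov⟩ := hd.exists_countable_cover (half_pos hr)
    -- Countably many cells of small `ρ`-diameter cover `X`; almost every point avoids the null
    -- ones.
    have h1 : ∀ᵐ x ∂μ, ∀ y ∈ c, ∀ q : ℚ, d y (π x) < r / 2 ∧ |e x - q| < r / 2 →
        μ {x | d y (π x) < r / 2 ∧ |e x - q| < r / 2} ≠ 0 := by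
      refine (ae_ball_iff hc).2 fun y _ => ae_all_iff.2 fun q => ?_
      by_cases h0 : μ {x | d y (π x) < r / 2 ∧ |e x - q| < r / 2} = 0
      · filter_upwards [measure_eq_zero_iff_ae_notMem.1 h0] with x hx hx'
        exact absurd hx' hx
      · exact ae_of_all _ fun x _ => h0
    filter_upwards [h1] with x hx
    obtain ⟨y, hy, hyx⟩ := hcov (π x)
    obtain ⟨q, hq⟩ := exists_rat_btwn (show e x - r / 2 < e x + r / 2 by linarith)
    have hqx : |e x - q| < r / 2 := abs_lt.2 ⟨by linarith, by linarith⟩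
    refine (pos_iff_ne_zero.2 (hx y hy q ⟨hyx, hqx⟩)).trans_le (measure_mono ?_)
    rintro w ⟨hw1, hw2⟩
    have h2 := hd.triangle (π x) y (π w)
    rw [hd.symm (π x) y] at h2
    have h3 : |e x - e w| < r := by
      rw [abs_lt] at hqx hw2 ⊢
      constructor <;> linarith
    have h4 : min 1 |e x - e w| < r := (min_le_right _ _).trans_lt h3
    change d (π x) (π w) / 2 + min 1 |e x - e w| / 2 < r
    linarith
  -- Balls must be positive at every point, including those outside `s`. Composing `ρ` with `φ`
  -- repairs this: injectivity keeps it a metric, and centers move into `s`.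
  obtain ⟨φ, hφ, hφinj, hφs, hφid⟩ := exists_injective_into_conull hs hsc
  refine ⟨fun x y => ρ (φ x) (φ y), φ, ?_, hφid, fun x y => ?_⟩
  · refine ⟨fun x y => ⟨fun h => ?_, ?_⟩, fun x y => ?_, fun x y z => ?_, fun x y => ?_, ?_,
      fun x r hr => ?_⟩
    · have h1 := hd.nonneg (π (φ x)) (π (φ y))
      have h2 := hmin (φ x) (φ y)
      have h3 : min 1 |e (φ x) - e (φ y)| = 0 := by
        change d _ _ / 2 + min 1 |e (φ x) - e (φ y)| / 2 = 0 at h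
        linarith
      rcases min_choice 1 |e (φ x) - e (φ y)| with h4 | h4
      · rw [h4] at h3; norm_num at h3
      · rw [h4] at h3
        exact hφinj (heinj (sub_eq_zero.1 (abs_eq_zero.1 h3)))
    · rintro rfl
      simp [ρ, hd.self_eq_zero]
    · simp only [ρ]
      rw [hd.symm, abs_sub_comm]
    · have h1 := hd.triangle (π (φ x)) (π (φ y)) (π (φ z))
      have h2 := min_one_le_add (abs_nonneg _) (abs_nonneg _)
        (abs_sub_le (e (φ x)) (e (φ y)) (e (φ z)))
      simp only [ρ]
      linarith
    · have h1 := hd.le_one (π (φ x)) (π (φ y))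
      have h2 := min_le_left 1 |e (φ x) - e (φ y)|
      change d _ _ / 2 + min 1 |e (φ x) - e (φ y)| / 2 ≤ 1
      linarith
    · exact hρm.comp ((hφ.comp measurable_fst).prodMk (hφ.comp measurable_snd))
    · obtain ⟨k, hk⟩ := exists_nat_one_div_lt hr
      refine (hφs x k).trans_le ?_
      refine measure_mono_ae ?_
      filter_upwards [hφid] with y hy (hy' : ρ (φ x) y < _)
      change ρ (φ x) (φ y) < r
      rw [hy]
      exact hy'.trans hk
  · have := hmin (φ x) (φ y)
    simp only [ρ]
    linarith

/-! ### Sensitivity excludes isometric factors -/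

/-- Li-Yorke M-sensitive transformations of nonatomic standard Borel spaces have no nontrivial
isometric factor. -/
theorem IsLiYorkeMSensitive.not_hasNontrivialIsometricFactor {X : Type u} [MeasurableSpace X]
    [StandardBorelSpace X] {μ : Measure X} [IsFiniteMeasure μ] [NullSingletonClass μ] {T : X → X}
    (hT : MeasurePreserving T μ μ) (hL : IsLiYorkeMSensitive T μ) :
    ¬ HasNontrivialIsometricFactor T μ := by
  rintro ⟨Y, _, _, ν, S, π, hfac, ⟨A, hA, hA0, hAc⟩, d, hd, hiso⟩
  have hπ := hfac.map.measurable
  have : IsFiniteMeasure ν := hfac.map.map_eq ▸ inferInstance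
  have : NeZero μ := ⟨by
    rintro rfl
    rw [← hfac.map.map_eq] at hA0
    simp at hA0⟩
  obtain ⟨D, φ, hD, hφ, hDd⟩ := hd.exists_lift (μ := μ) hπ
  have hiter : ∀ {p : X → Prop}, (∀ᵐ x ∂μ, p x) → ∀ᵐ x ∂μ, ∀ n : ℕ, p (T^[n] x) := fun h =>
    ae_all_iff.2 fun n => (hT.iterate n).quasiMeasurePreserving.ae h
  have hSiter : ∀ (n : ℕ) y y', d (S^[n] y) (S^[n] y') = d y y' := by
    intro n
    induction n with
    | zero => exact fun _ _ => rfl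
    | succ n ih => intro y y'; rw [Function.iterate_succ_apply', Function.iterate_succ_apply',
        hiso, ih]
  have hgood : ∀ᵐ x ∂μ, ∀ n : ℕ, π (φ (T^[n] x)) = S^[n] (π x) := by
    filter_upwards [hiter hφ, hiter hfac.equivariant] with x h1 h2 n
    rw [h1]
    induction n with
    | zero => rfl
    | succ n ih => rw [Function.iterate_succ_apply', Function.iterate_succ_apply', h2, ih]
  have hzero : ∀ᵐ p ∂(μ.prod μ), π p.1 = π p.2 := by
    filter_upwards [hL D hD, (Measure.quasiMeasurePreserving_fst (μ := μ) (ν := μ)).ae hgood,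
      (Measure.quasiMeasurePreserving_snd (μ := μ) (ν := μ)).ae hgood] with p hp h1 h2
    -- Along the orbit the lifted metric never drops below the constant `d (π p.1) (π p.2) / 2`,
    -- while its liminf is zero.
    have h3 : d (π p.1) (π p.2) / 2 ≤ liminf (fun n => D (T^[n] p.1) (T^[n] p.2)) atTop := by
      refine le_liminf_of_le (hD.isCoboundedUnder_ge _ _) (Eventually.of_forall fun n => ?_)
      have := hDd (T^[n] p.1) (T^[n] p.2)
      rwa [h1, h2, hSiter] at this
    rw [hp.1] at h3
    exact (hd.eq_zero_iff _ _).1 (le_antisymm (by linarith) (hd.nonneg _ _))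
  -- By Fubini almost every `y` has the same image as one fixed `x`, so `ν` is concentrated at `π
  -- x`.
  obtain ⟨x, hx⟩ := (Measure.ae_ae_of_ae_prod hzero).exists
  rw [← hfac.map.measure_preimage hA.nullMeasurableSet] at hA0
  rw [← hfac.map.measure_preimage hA.compl.nullMeasurableSet] at hAc
  by_cases hxA : π x ∈ A
  · refine hAc (measure_eq_zero_iff_ae_notMem.2 ?_)
    filter_upwards [hx] with y hy hyA
    exact hyA (hy ▸ hxA)
  · refine hA0 (measure_eq_zero_iff_ae_notMem.2 ?_)
    filter_upwards [hx] with y hy hyA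
    exact hxA (hy ▸ hyA)

end LiYorke

theorem mainTheorem4 {X : Type*} [MeasurableSpace X] [StandardBorelSpace X]
    (μ : MeasureTheory.Measure X) [MeasureTheory.IsFiniteMeasure μ] [MeasureTheory.NullSingletonClass μ]
    (T : X → X) (hT : Ergodic T μ) :
    (LiYorke.IsLiYorkeMSensitive T μ ↔ ¬ LiYorke.HasNontrivialIsometricFactor T μ) ∧
      (LiYorke.IsWeaklyMixing T μ ↔ ¬ LiYorke.HasNontrivialIsometricFactor T μ) := by
  have h1 : LiYorke.IsWeaklyMixing T μ → LiYorke.IsLiYorkeMSensitive T μ :=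
    LiYorke.IsWeaklyMixing.isLiYorkeMSensitive hT
  have h2 : LiYorke.IsLiYorkeMSensitive T μ → ¬ LiYorke.HasNontrivialIsometricFactor T μ :=
    LiYorke.IsLiYorkeMSensitive.not_hasNontrivialIsometricFactor hT.toMeasurePreserving
  have h3 : ¬ LiYorke.HasNontrivialIsometricFactor T μ → LiYorke.IsWeaklyMixing T μ :=
    not_imp_comm.1
      (LiYorke.hasNontrivialIsometricFactor_of_not_isWeaklyMixing hT.toMeasurePreserving)
  exact ⟨⟨h2, fun h => h1 (h3 h)⟩, ⟨fun h => h2 (h1 h), h3⟩⟩
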